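/- Let $q\in[1,\infty]$ and $d\ge 1$. For probability measures $\mu,\nu$ on $\mathbb R^d$ let $\mathsf R_q(\mu\,\|\,\nu)$ be the Rényi divergence: it is $+\infty$ if $\mu\not\ll\nu$, and otherwise $\mathsf R_q(\mu\,\|\,\nu)=\frac1{q-1}\log\int\bigl(\frac{d\mu}{d\nu}\bigr)^q\,d\nu$ for $1<q<\infty$, $\mathsf R_1=\mathrm{KL}$, and $\mathsf R_\infty(\mu\,\|\,\nu)=\log\bigl\|\frac{d\mu}{d\nu}\bigr\|_{L^\infty(\nu)}$. Let $W_\infty(\mu,\nu)=\inf_\gamma \operatorname{ess\,sup}_{(x,y)\sim\gamma}\|x-y\|$, where $\gamma$ ranges over the couplings of $\mu$ and $\nu$. Let $P,\hat P$ be Markov kernels on $\mathbb R^d$ and let $c,c',L,a,b\in\mathbb R$ with $L\le 1$ be such that for all $x,y\in\mathbb R^d$: 1. (Regularity) $\mathsf R_q(\delta_xP\,\|\,\delta_yP)\le c\,\|x-y\|^2$; 2. (Wasserstein bound) $W_\infty(\delta_x\hat P,\delta_yP)\le L\,\|x-y\|+a$; 3. (Cross-regularity) $\mathsf R_q(\delta_x\hat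 P\,\|\,\delta_yP)\le c'\,\|x-y\|^2+b^2$. For $N\ge1$ and $r\ge 0$ put, if $L<1$, $$B_N(r)=\Bigl(c+(c'-c)\,\frac{1-L^2}{1-L^{2N}}\Bigr)\Bigl(\frac{1+L}{1-L}\Bigr)\frac{\bigl(a\,(1-L^{N-1})+L^{N-1}(1-L)\,r\bigr)^2}{1-L^{2N}}+b^2 ,$$ and, if $L=1$, let $B_N(r)$ be the limit of this expression as $L\nearrow1$, that is, $$B_N(r)=\bigl((N-1)\,c+c'\bigr)\frac{(r+(N-1)\,a)^2}{N^2}+b^2 .$$ Then for every integer $N\ge 1$ and all $x,y\in\mathbb R^d$, $$\mathsf R_q(\delta_x\hat P^N\,\|\,\delta_yP^N)\le B_N(\|x-y\|)\qquad\text{whenever } \|x-y\|\ge a\text{ or }N=1,$$ and, with no restriction on $x,y$, $$\mathsf R_q(\delta_x\hat P^N\,\|\,\delta_yP^N)\le B_N\bigl(\max(\|x-y\|,a)\bigr).$$ -/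

import Mathlib

open MeasureTheory ProbabilityTheory
open scoped ENNReal

noncomputable section

open scoped Classical in
/-- The Rényi divergence of order `q ∈ [1, ∞]` between probability measures, with values in the
extended reals. It is `+∞` unless `μ ≪ ν`. For `q = 1` it is the Kullback-Leibler divergence, for
`q = ∞` it is the logarithm of the essential supremum of the density, and for `1 < q < ∞` it is
`(q - 1)⁻¹ log ∫ (dμ/dν)^q dν`. Orders `q < 1` are not meant to be used. -/
def renyiDiv {α : Type*} [MeasurableSpace α] (q : ℝ≥0∞) (μ ν : Measure α) : EReal :=
  if ¬ μ ≪ ν then ⊤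
  else if q = 1 then ((InformationTheory.klDiv μ ν : ℝ≥0∞) : EReal)
  else if q = ∞ then ENNReal.log (essSup (μ.rnDeriv ν) ν)
  else (((q.toReal - 1)⁻¹ : ℝ) : EReal) * ENNReal.log (∫⁻ z, (μ.rnDeriv ν z) ^ q.toReal ∂ν)

/-- The couplings of `μ` and `ν`: measures on the product with these marginals. -/
def couplings {α : Type*} [MeasurableSpace α] (μ ν : Measure α) : Set (Measure (α × α)) :=
  {γ | γ.map Prod.fst = μ ∧ γ.map Prod.snd = ν}

/-- The `∞`-Wasserstein distance: the infimum over all couplings of the essential supremum of the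
distance between the two coordinates. -/
def wassersteinInf {α : Type*} [MeasurableSpace α] [PseudoEMetricSpace α] (μ ν : Measure α) :
    ℝ≥0∞ :=
  ⨅ γ ∈ couplings μ ν, essSup (fun p : α × α => edist p.1 p.2) γ

/-- The explicit `N`-step bound (for `N ≥ 1`), as a function of the initial distance `r`. The value
at `L = 1`, where the general expression reads `0 / 0`, is its limit as `L` increases to `1`. -/
def couplingBound (c c' L a b : ℝ) (N : ℕ) (r : ℝ) : ℝ :=
  if L = 1 then
    ((N - 1 : ℝ) * c + c') * (r + (N - 1 : ℝ) * a) ^ 2 / (N : ℝ) ^ 2 + b ^ 2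
  else
    (c + (c' - c) * ((1 - L ^ 2) / (1 - L ^ (2 * N)))) * ((1 + L) / (1 - L)) *
      ((a * (1 - L ^ (N - 1)) + L ^ (N - 1) * (1 - L) * r) ^ 2 / (1 - L ^ (2 * N))) + b ^ 2

end

/-! For `q > 1`, the bound R_q(μ‖ν) ≤ m is equivalent to the Harnack inequality (∫ h dμ)^p ≤ e^m ∫
h^p dν for all measurable h ≥ 0, with p = q/(q-1), read as 1 if q = ∞. For `q = 1` the
Donsker–Varadhan inequality plays this role. Such inequalities chain along a coupling. This gives
the shifted composition rule `renyiDiv_bind_le`: the divergence of μ₁κ from μ₃η costs that of an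
auxiliary μ₂ from μ₃, plus the worst divergence of κ_x from η_y over a coupling of μ₁ and μ₂.

The theorem follows by induction, splitting off the first step. Move y towards x by u to a point z.
Passing from P z to P y costs c u², while Phat x and P z couple within L(r-u)+a, up to ε, and the
remaining steps start from there. The last step is not shifted and uses cross-regularity. With u =
`firstShift` the costs add up exactly to the claimed bound (`geomCouplingBound_succ`); a ≤ r ensures
u ≤ r (`firstShift_le`). -/

/-- A dimension-free Harnack inequality between two measures, with exponent `p` and constant `C`. -/
def HarnackIneq {α : Type*} [MeasurableSpace α] (p : ℝ) (C : ℝ≥0∞) (μ ν : Measure α) : Prop :=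
  ∀ h : α → ℝ≥0∞, Measurable h → (∫⁻ z, h z ∂μ) ^ p ≤ C * ∫⁻ z, h z ^ p ∂ν

/-- The logarithmic Harnack inequality between two measures, with additive constant `m`. -/
def LogHarnackIneq {α : Type*} [MeasurableSpace α] (m : ℝ) (μ ν : Measure α) : Prop :=
  ∀ φ : α → ℝ, Measurable φ → (∃ M : ℝ, ∀ z, |φ z| ≤ M) →
    ∫ z, φ z ∂μ ≤ Real.log (∫ z, Real.exp (φ z) ∂ν) + m

/-! ### Chaining Harnack inequalities along couplings. -/

section Harnack

variable {α β : Type*} [MeasurableSpace α] [MeasurableSpace β]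

theorem HarnackIneq.absolutelyContinuous {p : ℝ} {C : ℝ≥0∞} {μ ν : Measure α} (hp : 0 < p)
    (h : HarnackIneq p C μ ν) : μ ≪ ν := by
  refine Measure.AbsolutelyContinuous.mk fun s hs h0 => ?_
  have h1 := h (s.indicator 1) (measurable_one.indicator hs)
  have h2 : ∀ z, (s.indicator (1 : α → ℝ≥0∞) z) ^ p = s.indicator 1 z := fun z => by
    by_cases hz : z ∈ s <;> simp [hz, hp]
  simp only [h2, lintegral_indicator_one hs, h0, mul_zero, nonpos_iff_eq_zero] at h1
  exact (ENNReal.rpow_eq_zero_iff_of_pos hp).1 h1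

/-- Along γ, `h₂` bounds κh(x) by (C₂ η(h^p)(y))^(1/p). Then `h₁` is applied to this function of y,
whose p-th power is linear in η(h^p). -/
theorem HarnackIneq.comp {p : ℝ} {C₁ C₂ : ℝ≥0∞} (hp : 0 < p) {κ η : Kernel α β}
    {μ₁ μ₂ μ₃ : Measure α} {γ : Measure (α × α)} (hγ : γ ∈ couplings μ₁ μ₂)
    (h₁ : HarnackIneq p C₁ μ₂ μ₃)
    (h₂ : ∀ᵐ z ∂γ, HarnackIneq p C₂ (κ z.1) (η z.2)) :
    HarnackIneq p (C₁ * C₂) (μ₁.bind κ) (μ₃.bind η) := by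
  intro h hh
  have hhp : Measurable fun z => h z ^ p := hh.pow_const p
  have hmeas : Measurable fun y => (C₂ * ∫⁻ z, h z ^ p ∂η y) ^ p⁻¹ :=
    ((hhp.lintegral_kernel (κ := η)).const_mul _).pow_const _
  rw [Measure.lintegral_bind κ.measurable.aemeasurable hh.aemeasurable,
    Measure.lintegral_bind η.measurable.aemeasurable hhp.aemeasurable]
  have hle : ∫⁻ x, ∫⁻ z, h z ∂κ x ∂μ₁ ≤ ∫⁻ y, (C₂ * ∫⁻ z, h z ^ p ∂η y) ^ p⁻¹ ∂μ₂ := by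
    rw [← hγ.1, ← hγ.2, lintegral_map hh.lintegral_kernel measurable_fst,
      lintegral_map hmeas measurable_snd]
    refine lintegral_mono_ae ?_
    filter_upwards [h₂] with z hz
    exact (ENNReal.le_rpow_inv_iff hp).2 (hz h hh)
  calc _ ≤ (∫⁻ y, (C₂ * ∫⁻ z, h z ^ p ∂η y) ^ p⁻¹ ∂μ₂) ^ p := by gcongr
    _ ≤ _ := h₁ _ hmeas
    _ = _ := by
      simp_rw [ENNReal.rpow_inv_rpow hp.ne']
      rw [lintegral_const_mul _ hhp.lintegral_kernel, mul_assoc]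

theorem HarnackIneq.one_le {p : ℝ} {C : ℝ≥0∞} {μ ν : Measure α} [IsProbabilityMeasure μ]
    [IsProbabilityMeasure ν] (h : HarnackIneq p C μ ν) : 1 ≤ C := by
  simpa using h (fun _ => 1) measurable_const

theorem integrable_of_measurable_of_abs_le {μ : Measure α} [IsFiniteMeasure μ] {φ : α → ℝ} {M : ℝ}
    (hφ : Measurable φ) (hM : ∀ z, |φ z| ≤ M) : Integrable φ μ :=
  Integrable.of_bound hφ.aestronglyMeasurable M (ae_of_all _ hM)

theorem exp_mem_Icc_of_abs_le {t M : ℝ} (h : |t| ≤ M) :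
    Real.exp t ∈ Set.Icc (Real.exp (-M)) (Real.exp M) :=
  ⟨Real.exp_le_exp.2 (abs_le.1 h).1, Real.exp_le_exp.2 (abs_le.1 h).2⟩

theorem integrable_exp_of_abs_le {μ : Measure α} [IsFiniteMeasure μ] {φ : α → ℝ} {M : ℝ}
    (hφ : Measurable φ) (hM : ∀ z, |φ z| ≤ M) : Integrable (fun z => Real.exp (φ z)) μ :=
  integrable_of_measurable_of_abs_le hφ.exp fun z => by
    rw [Real.abs_exp]; exact (exp_mem_Icc_of_abs_le (hM z)).2

theorem integral_exp_mem_Icc {μ : Measure α} [IsProbabilityMeasure μ] {φ : α → ℝ} {M : ℝ}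
    (hφ : Measurable φ) (hM : ∀ z, |φ z| ≤ M) :
    ∫ z, Real.exp (φ z) ∂μ ∈ Set.Icc (Real.exp (-M)) (Real.exp M) := by
  have hi := integrable_exp_of_abs_le (μ := μ) hφ hM
  constructor
  · simpa using integral_mono (integrable_const _) hi fun z => (exp_mem_Icc_of_abs_le (hM z)).1
  · simpa using integral_mono hi (integrable_const _) fun z => (exp_mem_Icc_of_abs_le (hM z)).2

theorem integral_bind_kernel {κ : Kernel α β} {μ : Measure α} {f : β → ℝ}
    [IsSFiniteKernel κ] [SFinite μ] (hf : Integrable f (μ.bind κ)) :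
    ∫ z, f z ∂(μ.bind κ) = ∫ x, ∫ z, f z ∂κ x ∂μ := by
  have e : μ.bind κ = (κ ∘ₖ Kernel.const Unit μ) () := by
    rw [Kernel.comp_apply, Kernel.const_apply]
  rw [e] at hf ⊢
  rw [Kernel.integral_comp hf, Kernel.const_apply]

/-- The same chaining, with `h₁` applied to y ↦ log ∫ e^φ dη_y, which inherits the bound `M` of φ.
-/
theorem LogHarnackIneq.comp {m₁ m₂ : ℝ} {κ η : Kernel α β} [IsMarkovKernel κ] [IsMarkovKernel η]
    {μ₁ μ₂ μ₃ : Measure α} [IsProbabilityMeasure μ₁] [IsProbabilityMeasure μ₂]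
    [IsProbabilityMeasure μ₃] {γ : Measure (α × α)} (hγ : γ ∈ couplings μ₁ μ₂)
    (h₁ : LogHarnackIneq m₁ μ₂ μ₃)
    (h₂ : ∀ᵐ z ∂γ, LogHarnackIneq m₂ (κ z.1) (η z.2)) :
    LogHarnackIneq (m₁ + m₂) (μ₁.bind κ) (μ₃.bind η) := by
  rintro φ hφ ⟨M, hM⟩
  have : IsProbabilityMeasure γ := ⟨by
    rw [← Set.preimage_univ (f := Prod.fst), ← Measure.map_apply measurable_fst .univ, hγ.1]
    simp⟩
  set F : α → ℝ := fun x => ∫ z, φ z ∂κ x with hF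
  set E : α → ℝ := fun y => ∫ z, Real.exp (φ z) ∂η y with hE
  have hFm : Measurable F := (hφ.stronglyMeasurable.integral_kernel (κ := κ)).measurable
  have hEm : Measurable E := (hφ.exp.stronglyMeasurable.integral_kernel (κ := η)).measurable
  have hFb : ∀ x, |F x| ≤ M := fun x => by
    simpa using norm_integral_le_of_norm_le_const (μ := κ x) (f := φ) (C := M) (ae_of_all _ hM)
  have hEb : ∀ y, E y ∈ Set.Icc (Real.exp (-M)) (Real.exp M) := fun y =>
    integral_exp_mem_Icc hφ hM
  have hE0 : ∀ y, 0 < E y := fun y => (Real.exp_pos _).trans_le (hEb y).1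
  have hGb : ∀ y, |Real.log (E y)| ≤ M := fun y =>
    abs_le.2 ⟨(Real.le_log_iff_exp_le (hE0 y)).2 (hEb y).1, (Real.log_le_iff_le_exp (hE0 y)).2 (hEb y).2⟩
  have hGm : Measurable fun y => Real.log (E y) := hEm.log
  have hle : ∫ x, F x ∂μ₁ ≤ ∫ y, Real.log (E y) ∂μ₂ + m₂ := by
    have e1 : ∫ x, F x ∂μ₁ = ∫ z, F z.1 ∂γ := by
      rw [← hγ.1, integral_map measurable_fst.aemeasurable hFm.aestronglyMeasurable]
    have e2 : ∫ y, Real.log (E y) ∂μ₂ = ∫ z, Real.log (E z.2) ∂γ := by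
      rw [← hγ.2, integral_map measurable_snd.aemeasurable hGm.aestronglyMeasurable]
    have hi : Integrable (fun z : α × α => Real.log (E z.2)) γ :=
      integrable_of_measurable_of_abs_le (hGm.comp measurable_snd) fun z => hGb z.2
    have e3 : ∫ z, Real.log (E z.2) ∂γ + m₂ = ∫ z, (Real.log (E z.2) + m₂) ∂γ := by
      rw [integral_add hi (integrable_const _)]; simp
    rw [e1, e2, e3]
    refine integral_mono_ae
      (integrable_of_measurable_of_abs_le (hFm.comp measurable_fst) fun z => hFb z.1)
      (hi.add (integrable_const _)) ?_
    filter_upwards [h₂] with z hz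
    exact hz φ hφ ⟨M, hM⟩
  have h3 := h₁ _ hGm ⟨M, hGb⟩
  simp_rw [Real.exp_log (hE0 _)] at h3
  have e4 : ∫ z, φ z ∂(μ₁.bind κ) = ∫ x, F x ∂μ₁ :=
    integral_bind_kernel (integrable_of_measurable_of_abs_le hφ hM)
  have e5 : ∫ z, Real.exp (φ z) ∂(μ₃.bind η) = ∫ x, E x ∂μ₃ := integral_bind_kernel (integrable_exp_of_abs_le hφ hM)
  rw [e4, e5]
  linarith

end Harnack

/-! ### Rényi bounds as Harnack inequalities, and the composition rule. -/

section Duality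

variable {α : Type*} [MeasurableSpace α] {μ ν : Measure α}

theorem harnackIneq_one_iff [IsProbabilityMeasure μ] [IsProbabilityMeasure ν] {m : ℝ} :
    renyiDiv ∞ μ ν ≤ (m : EReal) ↔ HarnackIneq 1 (ENNReal.ofReal (Real.exp m)) μ ν := by
  have key : ENNReal.log (essSup (μ.rnDeriv ν) ν) ≤ (m : EReal) ↔
      ∀ᵐ z ∂ν, μ.rnDeriv ν z ≤ ENNReal.ofReal (Real.exp m) := by
    have e : (m : EReal) = ENNReal.log (ENNReal.ofReal (Real.exp m)) := by
      rw [ENNReal.log_ofReal_of_pos (Real.exp_pos m), Real.log_exp]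
    rw [e, ENNReal.log_le_log_iff]
    exact ⟨fun h => (ENNReal.ae_le_essSup _).mono fun z hz => hz.trans h,
      fun h => essSup_le_of_ae_le _ h⟩
  constructor
  · intro h
    have hac : μ ≪ ν := by
      by_contra hac
      simp [renyiDiv, hac] at h
    simp only [renyiDiv, hac, not_true_eq_false, if_false, ENNReal.top_ne_one, if_true] at h
    intro g hg
    simp only [ENNReal.rpow_one]
    rw [← lintegral_rnDeriv_mul hac hg.aemeasurable, ← lintegral_const_mul _ hg]
    exact lintegral_mono_ae ((key.1 h).mono fun z hz => by gcongr)
  · intro h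
    have hac := h.absolutelyContinuous one_pos
    simp only [renyiDiv, hac, not_true_eq_false, if_false, ENNReal.top_ne_one, if_true]
    refine key.2 (ae_le_of_forall_setLIntegral_le_of_sigmaFinite (Measure.measurable_rnDeriv _ _)
      fun s hs _ => ?_)
    have h1 := h (s.indicator 1) (measurable_one.indicator hs)
    simp only [ENNReal.rpow_one, lintegral_indicator_one hs] at h1
    rw [Measure.setLIntegral_rnDeriv hac]
    simpa using h1

theorem renyiDiv_le_iff_of_ac {q : ℝ≥0∞} (hq : 1 < q) (hq' : q ≠ ∞) (hac : μ ≪ ν) {m : ℝ} :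
    renyiDiv q μ ν ≤ (m : EReal) ↔
      (∫⁻ z, μ.rnDeriv ν z ^ q.toReal ∂ν) ^ (q.toReal - 1)⁻¹ ≤ ENNReal.ofReal (Real.exp m) := by
  have e : (m : EReal) = ENNReal.log (ENNReal.ofReal (Real.exp m)) := by
    rw [ENNReal.log_ofReal_of_pos (Real.exp_pos m), Real.log_exp]
  simp only [renyiDiv, hac, not_true_eq_false, if_false, hq.ne', hq']
  rw [← ENNReal.log_rpow, e, ENNReal.log_le_log_iff]

theorem one_lt_toReal {q : ℝ≥0∞} (hq : 1 < q) (hq' : q ≠ ∞) : 1 < q.toReal := by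
  simpa using (ENNReal.toReal_lt_toReal ENNReal.one_ne_top hq').2 hq

/-- Hölder's inequality for the product of dμ/dν and the test function. -/
theorem harnackIneq_of_renyiDiv_le [IsProbabilityMeasure μ] [IsProbabilityMeasure ν] {q : ℝ≥0∞}
    (hq : 1 < q) (hq' : q ≠ ∞) {m : ℝ} (h : renyiDiv q μ ν ≤ (m : EReal)) :
    HarnackIneq (q.toReal / (q.toReal - 1)) (ENNReal.ofReal (Real.exp m)) μ ν := by
  have hac : μ ≪ ν := by
    by_contra hac
    simp [renyiDiv, hac] at h
  rw [renyiDiv_le_iff_of_ac hq hq' hac] at h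
  have hQ := one_lt_toReal hq hq'
  set Q := q.toReal
  have hconj : Q.HolderConjugate (Q / (Q - 1)) := Real.HolderConjugate.conjExponent hQ
  have hp : 0 < Q / (Q - 1) := hconj.symm.pos
  have hQ1 : Q - 1 ≠ 0 := by linarith
  have hQ0 : Q ≠ 0 := by linarith
  intro g hg
  have hm : Measurable (μ.rnDeriv ν) := Measure.measurable_rnDeriv _ _
  calc (∫⁻ z, g z ∂μ) ^ (Q / (Q - 1))
      = (∫⁻ z, (μ.rnDeriv ν * g) z ∂ν) ^ (Q / (Q - 1)) := by
        rw [← lintegral_rnDeriv_mul hac hg.aemeasurable]; rfl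
    _ ≤ ((∫⁻ z, μ.rnDeriv ν z ^ Q ∂ν) ^ (1 / Q) *
          (∫⁻ z, g z ^ (Q / (Q - 1)) ∂ν) ^ (1 / (Q / (Q - 1)))) ^ (Q / (Q - 1)) := by
        gcongr
        exact ENNReal.lintegral_mul_le_Lp_mul_Lq ν hconj hm.aemeasurable hg.aemeasurable
    _ = (∫⁻ z, μ.rnDeriv ν z ^ Q ∂ν) ^ (Q - 1)⁻¹ * ∫⁻ z, g z ^ (Q / (Q - 1)) ∂ν := by
        rw [ENNReal.mul_rpow_of_nonneg _ _ hp.le, ← ENNReal.rpow_mul, ← ENNReal.rpow_mul,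
          one_div_mul_cancel hp.ne', ENNReal.rpow_one]
        congr 2
        field_simp
    _ ≤ _ := by gcongr

/-- The extremal test function in Hölder is f^(Q-1), where f = dμ/dν. It is used with f truncated at
n, and monotone convergence removes the truncation. -/
theorem renyiDiv_le_of_harnackIneq [IsProbabilityMeasure μ] [IsProbabilityMeasure ν] {q : ℝ≥0∞}
    (hq : 1 < q) (hq' : q ≠ ∞) {m : ℝ}
    (h : HarnackIneq (q.toReal / (q.toReal - 1)) (ENNReal.ofReal (Real.exp m)) μ ν) :
    renyiDiv q μ ν ≤ (m : EReal) := by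
  have hQ := one_lt_toReal hq hq'
  have hQ1 : 0 < q.toReal - 1 := by linarith
  have hac : μ ≪ ν := h.absolutelyContinuous (div_pos (by linarith) hQ1)
  rw [renyiDiv_le_iff_of_ac hq hq' hac]
  set Q := q.toReal
  set C := ENNReal.ofReal (Real.exp m)
  set f := μ.rnDeriv ν
  have hm : Measurable f := Measure.measurable_rnDeriv _ _
  have hfn : ∀ n : ℕ, Measurable fun z => min (f z) n := fun n => hm.min measurable_const
  have hlim : Filter.Tendsto (fun n : ℕ => ∫⁻ z, (min (f z) n) ^ Q ∂ν) Filter.atTop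
      (nhds (∫⁻ z, f z ^ Q ∂ν)) := by
    refine lintegral_tendsto_of_tendsto_of_monotone (fun n => ((hfn n).pow_const _).aemeasurable)
      (ae_of_all _ fun z n k hnk => ?_) (ae_of_all _ fun z => ?_)
    · have : (n : ℝ≥0∞) ≤ k := by exact_mod_cast hnk
      dsimp only
      gcongr
    · have h1 : Filter.Tendsto (fun n : ℕ => min (f z) (n : ℝ≥0∞)) Filter.atTop
          (nhds (min (f z) ∞)) := tendsto_const_nhds.min ENNReal.tendsto_nat_nhds_top
      rw [min_eq_left le_top] at h1
      exact (ENNReal.continuous_rpow_const.tendsto _).comp h1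
  rw [ENNReal.rpow_inv_le_iff hQ1]
  refine le_of_tendsto' hlim fun n => ?_
  rw [← ENNReal.rpow_inv_le_iff hQ1]
  set I := ∫⁻ z, (min (f z) n) ^ Q ∂ν
  -- Finiteness, due to the truncation, allows cancelling `I` from I^(Q/(Q-1)) ≤ C I.
  have hI : I ≠ ∞ := by
    refine ne_top_of_le_ne_top (b := (n : ℝ≥0∞) ^ Q)
      (ENNReal.rpow_ne_top_of_nonneg (by linarith) (ENNReal.natCast_ne_top n)) ?_
    calc I ≤ ∫⁻ z, (n : ℝ≥0∞) ^ Q ∂ν := lintegral_mono fun z => by gcongr; exact min_le_right _ _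
      _ = _ := by simp
  rcases eq_or_ne I 0 with h0 | h0
  · rw [h0, ENNReal.zero_rpow_of_pos (inv_pos.2 hQ1)]; exact zero_le
  have h1 := h (fun z => min (f z) n ^ (Q - 1)) ((hfn n).pow_const _)
  rw [← lintegral_rnDeriv_mul hac ((hfn n).pow_const _).aemeasurable] at h1
  simp_rw [← ENNReal.rpow_mul, mul_div_cancel₀ Q hQ1.ne'] at h1
  have h2 : I ≤ ∫⁻ z, f z * min (f z) n ^ (Q - 1) ∂ν := lintegral_mono fun z => by
    have : min (f z) (n : ℝ≥0∞) ^ Q = min (f z) n * min (f z) n ^ (Q - 1) := by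
      conv_lhs => rw [show Q = 1 + (Q - 1) by ring]
      rw [ENNReal.rpow_add_of_nonneg _ _ zero_le_one hQ1.le, ENNReal.rpow_one]
    dsimp only
    rw [this]
    gcongr
    exact min_le_left _ _
  have h3 : I ^ (Q / (Q - 1)) ≤ C * I := (by gcongr : I ^ (Q / (Q - 1)) ≤ _).trans h1
  rw [show Q / (Q - 1) = (Q - 1)⁻¹ + 1 by field_simp; ring,
    ENNReal.rpow_add_of_nonneg _ _ (inv_pos.2 hQ1).le zero_le_one, ENNReal.rpow_one] at h3
  exact (ENNReal.mul_le_mul_iff_left h0 hI).1 h3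

/-- This is KL(μ‖ν_φ) ≥ 0 for the tilted measure ν_φ ∝ e^φ ν. -/
theorem logHarnackIneq_of_renyiDiv_le [IsProbabilityMeasure μ] [IsProbabilityMeasure ν] {m : ℝ}
    (h : renyiDiv 1 μ ν ≤ (m : EReal)) : LogHarnackIneq m μ ν := by
  have hac : μ ≪ ν := by
    by_contra hac
    simp [renyiDiv, hac] at h
  simp only [renyiDiv, hac, not_true_eq_false, if_false, if_true] at h
  have htop : InformationTheory.klDiv μ ν ≠ ∞ := fun h0 => by simp [h0] at h
  have hint := (InformationTheory.klDiv_ne_top_iff.1 htop).2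
  rw [InformationTheory.klDiv_of_ac_of_integrable hac hint] at h
  rintro φ hφ ⟨M, hM⟩
  have hexp := integrable_exp_of_abs_le (μ := ν) hφ hM
  have : IsProbabilityMeasure (ν.tilted φ) := isProbabilityMeasure_tilted hexp
  have hφi := integrable_of_measurable_of_abs_le (μ := μ) hφ hM
  have h1 := InformationTheory.integral_llr_add_sub_measure_univ_nonneg
    (hac.trans (absolutelyContinuous_tilted hexp))
    (integrable_llr_tilted_right hac hφi hint hexp)
  rw [integral_llr_tilted_right hac hφi hexp hint] at h1
  simp only [probReal_univ, add_sub_cancel_right] at h h1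
  have h2 : ∫ z, llr μ ν z ∂μ ≤ m := by
    rw [EReal.coe_ennreal_ofReal, EReal.coe_le_coe_iff] at h
    exact (le_max_left _ _).trans h
  linarith

theorem LogHarnackIneq.absolutelyContinuous [IsProbabilityMeasure μ] [IsProbabilityMeasure ν]
    {m : ℝ} (h : LogHarnackIneq m μ ν) : μ ≪ ν := by
  refine Measure.AbsolutelyContinuous.mk fun s hs h0 => ?_
  -- Testing with t·1_s, where e^φ = 1 holds ν-a.e.; large t then forces μ(s) = 0.
  have h1 : ∀ t : ℝ, t * μ.real s ≤ m := fun t => by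
    have h2 := h (s.indicator fun _ => t) (measurable_const.indicator hs) ⟨|t|, fun z => by
      by_cases hz : z ∈ s <;> simp [hz]⟩
    have h3 : ∫ z, Real.exp (s.indicator (fun _ => t) z) ∂ν = 1 := by
      rw [integral_congr_ae (g := fun _ => (1 : ℝ)) ?_]
      · simp
      · filter_upwards [measure_eq_zero_iff_ae_notMem.1 h0] with z hz
        simp [hz]
    rw [h3, integral_indicator_const t hs, Real.log_one, zero_add, smul_eq_mul, mul_comm] at h2
    exact h2
  rw [← measureReal_eq_zero_iff]
  by_contra h2
  have h3 := h1 ((m + 1) / μ.real s)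
  rw [div_mul_cancel₀ _ h2] at h3
  linarith

/-- The logarithm, truncated to `[-n, n]` and with the value `-n` at `0`. -/
noncomputable def truncLog (n : ℕ) (t : ℝ) : ℝ :=
  if t = 0 then -n else max (-n) (min n (Real.log t))

theorem measurable_truncLog (n : ℕ) : Measurable (truncLog n) :=
  Measurable.ite (measurableSet_singleton 0) measurable_const
    (measurable_const.max (measurable_const.min Real.measurable_log))

theorem abs_truncLog_le (n : ℕ) (t : ℝ) : |truncLog n t| ≤ n := by
  have hn : (0 : ℝ) ≤ n := n.cast_nonneg
  unfold truncLog
  split_ifs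
  · simp
  · exact abs_le.2 ⟨le_max_left _ _, max_le (by linarith) (min_le_left _ _)⟩

/-- For t > 0 the truncated value s lies between 0 and log t, so ts ≥ s e^s, and s e^s - e^s + 1 ≥
0. Nonnegativity is what Fatou's lemma needs later. -/
theorem mul_truncLog_sub_exp_nonneg (n : ℕ) {t : ℝ} (ht : 0 ≤ t) :
    0 ≤ t * truncLog n t - Real.exp (truncLog n t) + 1 := by
  have hn : (0 : ℝ) ≤ n := n.cast_nonneg
  have key : ∀ s : ℝ, 0 ≤ s * Real.exp s - Real.exp s + 1 := fun s => by
    have h1 := Real.add_one_le_exp (-s)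
    have h2 : Real.exp (-s) * Real.exp s = 1 := by rw [← Real.exp_add]; simp
    nlinarith [Real.exp_pos s]
  unfold truncLog
  split_ifs with h0
  · have : Real.exp (-(n : ℝ)) ≤ 1 := Real.exp_le_one_iff.2 (by linarith)
    rw [h0]; linarith
  · have htp : 0 < t := lt_of_le_of_ne ht (Ne.symm h0)
    set l := Real.log t
    have hl : t = Real.exp l := (Real.exp_log htp).symm
    set s := max (-(n : ℝ)) (min n l) with hs
    have h1 := key s
    have h2 : s * Real.exp s ≤ t * s := by
      rw [hl]
      rcases le_total 0 l with hl0 | hl0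
      · have a1 : 0 ≤ s := (le_min hn hl0).trans (le_max_right _ _)
        have a2 : s ≤ l := max_le (by linarith) (min_le_right _ _)
        nlinarith [Real.exp_le_exp.2 a2]
      · have a1 : s ≤ 0 := max_le (by linarith) ((min_le_right _ _).trans hl0)
        have a2 : l ≤ s := by
          refine le_trans ?_ (le_max_right _ _)
          exact le_min (by linarith) le_rfl
        nlinarith [Real.exp_le_exp.2 a2]
    linarith

theorem tendsto_mul_truncLog_sub_exp {t : ℝ} (ht : 0 ≤ t) :
    Filter.Tendsto (fun n => t * truncLog n t - Real.exp (truncLog n t) + 1) Filter.atTop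
      (nhds (InformationTheory.klFun t)) := by
  rcases ht.eq_or_lt with rfl | ht
  · have h1 : Filter.Tendsto (fun n : ℕ => Real.exp (-(n : ℝ))) Filter.atTop (nhds 0) :=
      Real.tendsto_exp_neg_atTop_nhds_zero.comp tendsto_natCast_atTop_atTop
    simpa [truncLog, InformationTheory.klFun_zero] using (h1.neg.add_const 1)
  · refine tendsto_const_nhds.congr' ?_
    filter_upwards [Filter.eventually_ge_atTop ⌈|Real.log t|⌉₊] with n hn
    have h1 := abs_le.1 (Nat.ceil_le.1 hn)
    have h2 : truncLog n t = Real.log t := by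
      rw [truncLog, if_neg ht.ne', min_eq_right h1.2, max_eq_right h1.1]
    rw [h2, Real.exp_log ht, InformationTheory.klFun_apply]
    ring

/-- The optimal φ is log dμ/dν, used in truncated form. The inequality log s ≤ s - 1 linearizes the
log-Harnack bound, and Fatou's lemma passes to the limit. -/
theorem renyiDiv_le_of_logHarnackIneq [IsProbabilityMeasure μ] [IsProbabilityMeasure ν] {m : ℝ}
    (h : LogHarnackIneq m μ ν) : renyiDiv 1 μ ν ≤ (m : EReal) := by
  have hac := h.absolutelyContinuous
  have hm0 : 0 ≤ m := by simpa using h (fun _ => 0) measurable_const ⟨0, by simp⟩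
  simp only [renyiDiv, hac, not_true_eq_false, if_false, if_true]
  suffices hs : InformationTheory.klDiv μ ν ≤ ENNReal.ofReal m by
    refine (EReal.coe_ennreal_le_coe_ennreal_iff.2 hs).trans_eq ?_
    rw [EReal.coe_ennreal_ofReal, max_eq_left hm0]
  rw [InformationTheory.klDiv_eq_lintegral_klFun_of_ac hac]
  set f : α → ℝ := fun z => (μ.rnDeriv ν z).toReal
  have hf0 : ∀ z, 0 ≤ f z := fun z => ENNReal.toReal_nonneg
  have hf : Measurable f := (Measure.measurable_rnDeriv _ _).ennreal_toReal
  have hφ : ∀ n, Measurable fun z => truncLog n (f z) := fun n => (measurable_truncLog n).comp hf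
  set g : ℕ → α → ℝ := fun n z => f z * truncLog n (f z) - Real.exp (truncLog n (f z)) + 1
  have hg : ∀ n, Measurable (g n) := fun n => ((hf.mul (hφ n)).sub (hφ n).exp).add_const 1
  have hlim : ∀ z, ENNReal.ofReal (InformationTheory.klFun (f z)) =
      Filter.liminf (fun n => ENNReal.ofReal (g n z)) Filter.atTop := fun z =>
    ((ENNReal.continuous_ofReal.tendsto _).comp
      (tendsto_mul_truncLog_sub_exp (hf0 z))).liminf_eq.symm
  calc ∫⁻ z, ENNReal.ofReal (InformationTheory.klFun (f z)) ∂ν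
      = ∫⁻ z, Filter.liminf (fun n => ENNReal.ofReal (g n z)) Filter.atTop ∂ν := by
        simp_rw [hlim]
    _ ≤ Filter.liminf (fun n => ∫⁻ z, ENNReal.ofReal (g n z) ∂ν) Filter.atTop :=
        lintegral_liminf_le fun n => (hg n).ennreal_ofReal
    _ ≤ ENNReal.ofReal m := by
        refine Filter.liminf_le_of_le (by isBoundedDefault) fun b hb => ?_
        obtain ⟨n, hn⟩ := hb.exists
        refine hn.trans ?_
        have hb := fun z => abs_truncLog_le n (f z)
        have hi1 : Integrable (fun z => f z * truncLog n (f z)) ν :=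
          (integrable_rnDeriv_smul_iff hac).2 (integrable_of_measurable_of_abs_le (hφ n) hb)
        have hi2 := integrable_exp_of_abs_le (μ := ν) (hφ n) hb
        have hi3 : Integrable (fun z => f z * truncLog n (f z) - Real.exp (truncLog n (f z))) ν :=
          hi1.sub hi2
        have hi4 : Integrable (g n) ν := hi3.add (integrable_const 1)
        rw [← ofReal_integral_eq_lintegral_ofReal hi4
          (ae_of_all _ fun z => mul_truncLog_sub_exp_nonneg n (hf0 z))]
        refine ENNReal.ofReal_le_ofReal ?_
        have e1 : ∫ z, f z * truncLog n (f z) ∂ν = ∫ z, truncLog n (f z) ∂μ :=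
          integral_rnDeriv_smul hac
        change ∫ z, (f z * truncLog n (f z) - Real.exp (truncLog n (f z)) + 1) ∂ν ≤ m
        rw [integral_add hi3 (integrable_const 1), integral_sub hi1 hi2, e1]
        have h1 := h _ (hφ n) ⟨n, hb⟩
        have h2 := Real.log_le_sub_one_of_pos
          ((Real.exp_pos _).trans_le (integral_exp_mem_Icc (μ := ν) (hφ n) hb).1)
        simp only [integral_const, probReal_univ, smul_eq_mul, mul_one]
        linarith

/-- **Shifted composition rule** for Rényi divergences. -/
theorem renyiDiv_bind_le {α β : Type*} [MeasurableSpace α] [MeasurableSpace β] {q : ℝ≥0∞}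
    (hq : 1 ≤ q) {κ η : Kernel α β} [IsMarkovKernel κ] [IsMarkovKernel η]
    {μ₁ μ₂ μ₃ : Measure α} [IsProbabilityMeasure μ₁] [IsProbabilityMeasure μ₂]
    [IsProbabilityMeasure μ₃] {γ : Measure (α × α)} (hγ : γ ∈ couplings μ₁ μ₂) {m₁ m₂ : ℝ}
    (h₁ : renyiDiv q μ₂ μ₃ ≤ (m₁ : EReal))
    (h₂ : ∀ᵐ z ∂γ, renyiDiv q (κ z.1) (η z.2) ≤ (m₂ : EReal)) :
    renyiDiv q (μ₁.bind κ) (μ₃.bind η) ≤ ((m₁ + m₂ : ℝ) : EReal) := by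
  rcases hq.eq_or_lt with rfl | hq1
  · exact renyiDiv_le_of_logHarnackIneq ((logHarnackIneq_of_renyiDiv_le h₁).comp hγ
      (h₂.mono fun z hz => logHarnackIneq_of_renyiDiv_le hz))
  have hC : ENNReal.ofReal (Real.exp (m₁ + m₂)) =
      ENNReal.ofReal (Real.exp m₁) * ENNReal.ofReal (Real.exp m₂) := by
    rw [Real.exp_add, ENNReal.ofReal_mul (Real.exp_pos _).le]
  by_cases hq' : q = ∞
  · subst hq'
    rw [harnackIneq_one_iff, hC]
    exact (harnackIneq_one_iff.1 h₁).comp one_pos hγ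
      (h₂.mono fun z hz => harnackIneq_one_iff.1 hz)
  · have hQ := one_lt_toReal hq1 hq'
    refine renyiDiv_le_of_harnackIneq hq1 hq' ?_
    rw [hC]
    exact (harnackIneq_of_renyiDiv_le hq1 hq' h₁).comp (div_pos (by linarith) (by linarith)) hγ
      (h₂.mono fun z hz => harnackIneq_of_renyiDiv_le hq1 hq' hz)

theorem nonneg_of_renyiDiv_le [IsProbabilityMeasure μ] [IsProbabilityMeasure ν] {q : ℝ≥0∞}
    (hq : 1 ≤ q) {m : ℝ} (h : renyiDiv q μ ν ≤ (m : EReal)) : 0 ≤ m := by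
  rcases hq.eq_or_lt with rfl | hq1
  · simpa using logHarnackIneq_of_renyiDiv_le h (fun _ => 0) measurable_const ⟨0, by simp⟩
  have h1 : 1 ≤ ENNReal.ofReal (Real.exp m) := by
    by_cases hq' : q = ∞
    · subst hq'
      exact (harnackIneq_one_iff.1 h).one_le
    · exact (harnackIneq_of_renyiDiv_le hq1 hq' h).one_le
  exact Real.one_le_exp_iff.1 (ENNReal.one_le_ofReal.1 h1)

end Duality

/-! ### The explicit bound and its recursion. -/

section Bound

/-- `couplingBound` for `n + 1` steps, written with geometric sums. -/
noncomputable def geomCouplingBound (c c' L a b : ℝ) (n : ℕ) (r : ℝ) : ℝ :=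
  (c * ((∑ j ∈ Finset.range (n + 1), (L ^ 2) ^ j) - 1) + c') *
    ((L ^ n * r + a * ∑ j ∈ Finset.range n, L ^ j) /
      ∑ j ∈ Finset.range (n + 1), (L ^ 2) ^ j) ^ 2 + b ^ 2

theorem geom_sum_sq_pos (L : ℝ) (n : ℕ) : 0 < ∑ j ∈ Finset.range (n + 1), (L ^ 2) ^ j := by
  rw [Finset.sum_range_succ']
  have : 0 ≤ ∑ j ∈ Finset.range n, (L ^ 2) ^ (j + 1) := Finset.sum_nonneg fun j _ => by positivity
  rw [pow_zero]
  linarith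

theorem couplingBound_eq_geomCouplingBound (c c' L a b : ℝ) (hL0 : 0 ≤ L) (n : ℕ) (r : ℝ) :
    couplingBound c c' L a b (n + 1) r = geomCouplingBound c c' L a b n r := by
  have hT := geom_sum_sq_pos L n
  unfold couplingBound geomCouplingBound
  split_ifs with h
  · subst h
    have : (n : ℝ) + 1 ≠ 0 := by positivity
    simp
    field_simp
  · have hL1 : 1 - L ≠ 0 := sub_ne_zero.2 (Ne.symm h)
    have hL2 : 1 + L ≠ 0 := by positivity
    have e1 := mul_neg_geom_sum L n
    have e2 := mul_neg_geom_sum (L ^ 2) (n + 1)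
    rw [← pow_mul] at e2
    rw [Nat.add_sub_cancel, ← e1, ← e2]
    set T := ∑ j ∈ Finset.range (n + 1), (L ^ 2) ^ j
    set S := ∑ j ∈ Finset.range n, L ^ j
    rw [show 1 - L ^ 2 = (1 - L) * (1 + L) by ring]
    field_simp
    ring

theorem continuous_geomCouplingBound (c c' L a b : ℝ) (n : ℕ) :
    Continuous (geomCouplingBound c c' L a b n) := by
  unfold geomCouplingBound
  fun_prop

/-- The size of the first shift of the auxiliary chain started at distance `r`, when `n + 2` steps
remain. -/
noncomputable def firstShift (L a : ℝ) (n : ℕ) (r : ℝ) : ℝ :=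
  L ^ (n + 1) * ((L ^ (n + 1) * r + a * ∑ j ∈ Finset.range (n + 1), L ^ j) /
    ∑ j ∈ Finset.range (n + 2), (L ^ 2) ^ j)

/-- The shift is chosen so that the squared quotient λ in `geomCouplingBound` is the same before and
after the step. The shift is L^(n+1) λ, so its cost is exactly the new summand c L^(2(n+1)) λ². -/
theorem geomCouplingBound_succ (c c' L a b : ℝ) (n : ℕ) (r : ℝ) :
    geomCouplingBound c c' L a b (n + 1) r = c * firstShift L a n r ^ 2 +
      geomCouplingBound c c' L a b n (L * (r - firstShift L a n r) + a) := by
  have hT := geom_sum_sq_pos L n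
  have hT' := geom_sum_sq_pos L (n + 1)
  unfold geomCouplingBound firstShift
  rw [Finset.sum_range_succ _ (n + 1)] at hT' ⊢
  rw [Finset.sum_range_succ (fun j => L ^ j) n, ← pow_mul] at *
  set T := ∑ j ∈ Finset.range (n + 1), (L ^ 2) ^ j
  set S := ∑ j ∈ Finset.range n, L ^ j
  rw [show L ^ (2 * (n + 1)) = (L ^ n * L) ^ 2 by ring] at *
  rw [pow_succ L n]
  generalize L ^ n = x at *
  have hT0 := hT.ne'
  have hT0' := hT'.ne'
  set lam := (x * L * r + a * (S + x)) / (T + (x * L) ^ 2) with hlam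
  have e : x * (L * (r - x * L * lam) + a) + a * S = lam * T := by
    have : lam * (T + (x * L) ^ 2) = x * L * r + a * (S + x) := div_mul_cancel₀ _ hT0'
    linear_combination this * (-1)
  rw [e, mul_div_cancel_right₀ _ hT0]
  ring

theorem firstShift_nonneg {L a r : ℝ} (hL0 : 0 ≤ L) (ha : 0 ≤ a) (hr : 0 ≤ r) (n : ℕ) :
    0 ≤ firstShift L a n r := by
  unfold firstShift
  positivity

theorem firstShift_le {L a r : ℝ} (hL0 : 0 ≤ L) (hL : L ≤ 1) (ha : 0 ≤ a) (har : a ≤ r) (n : ℕ) :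
    firstShift L a n r ≤ r := by
  have hT := geom_sum_sq_pos L (n + 1)
  unfold firstShift
  rw [← mul_div_assoc, div_le_iff₀ hT, Finset.sum_range_succ _ (n + 1)]
  -- Termwise: n+1+j ≥ 2j and 0 ≤ L ≤ 1.
  have h1 : L ^ (n + 1) * ∑ j ∈ Finset.range (n + 1), L ^ j ≤
      ∑ j ∈ Finset.range (n + 1), (L ^ 2) ^ j := by
    rw [Finset.mul_sum]
    refine Finset.sum_le_sum fun j hj => ?_
    rw [← pow_add, ← pow_mul]
    refine pow_le_pow_of_le_one hL0 hL ?_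
    have := Finset.mem_range.1 hj
    omega
  have h2 : 0 ≤ ∑ j ∈ Finset.range (n + 1), (L ^ 2) ^ j := (geom_sum_sq_pos L n).le
  have h3 : a * (L ^ (n + 1) * ∑ j ∈ Finset.range (n + 1), L ^ j) ≤
      r * ∑ j ∈ Finset.range (n + 1), (L ^ 2) ^ j :=
    (mul_le_mul_of_nonneg_left h1 ha).trans (mul_le_mul_of_nonneg_right har h2)
  rw [← pow_mul, show L ^ (2 * (n + 1)) = L ^ (n + 1) * L ^ (n + 1) by ring]
  linarith

end Bound

/-! ### Auxiliary points, couplings and the induction. -/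

theorem exists_norm_sub_le_and_norm_sub_le {E : Type*} [NormedAddCommGroup E] [NormedSpace ℝ E]
    {x y : E} {r u : ℝ} (hxy : ‖x - y‖ ≤ r) (hu : 0 ≤ u) (hur : u ≤ r) :
    ∃ z : E, ‖z - y‖ ≤ u ∧ ‖x - z‖ ≤ r - u := by
  rcases (hu.trans hur).eq_or_lt with h0 | h0
  · exact ⟨y, by simpa using hu, by linarith⟩
  · have ht : 0 ≤ u / r := by positivity
    have ht1 : 0 ≤ 1 - u / r := sub_nonneg.2 ((div_le_one h0).2 hur)
    have e : u / r * r = u := div_mul_cancel₀ _ h0.ne'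
    refine ⟨y + (u / r) • (x - y), ?_, ?_⟩
    · rw [add_sub_cancel_left, norm_smul, Real.norm_of_nonneg ht]
      nlinarith
    · rw [show x - (y + (u / r) • (x - y)) = (1 - u / r) • (x - y) by module, norm_smul,
        Real.norm_of_nonneg ht1]
      nlinarith

theorem exists_coupling_of_wassersteinInf_lt {E : Type*} [NormedAddCommGroup E] [MeasurableSpace E]
    {μ ν : Measure E} {r : ℝ} (h : wassersteinInf μ ν < ENNReal.ofReal r) :
    ∃ γ ∈ couplings μ ν, ∀ᵐ z ∂γ, ‖z.1 - z.2‖ ≤ r := by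
  simp only [wassersteinInf, iInf_lt_iff] at h
  obtain ⟨γ, hγ, hlt⟩ := h
  refine ⟨γ, hγ, ?_⟩
  have hr : 0 < r := ENNReal.ofReal_pos.1 (bot_le.trans_lt hlt)
  filter_upwards [ENNReal.ae_le_essSup (fun p : E × E => edist p.1 p.2)] with z hz
  have h1 := hz.trans hlt.le
  rwa [edist_dist, ENNReal.ofReal_le_ofReal_iff hr.le, dist_eq_norm] at h1

instance Kernel.isMarkovKernel_pow {α : Type*} [MeasurableSpace α] (κ : Kernel α α)
    [IsMarkovKernel κ] (n : ℕ) : IsMarkovKernel (κ ^ n) := by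
  induction n with
  | zero => rw [pow_zero]; exact inferInstanceAs (IsMarkovKernel Kernel.id)
  | succ n ih => rw [pow_succ]; exact inferInstanceAs (IsMarkovKernel ((κ ^ n) ∘ₖ κ))

/-- Any r ≥ ‖x - y‖ is allowed because couplings control distances only from above; this also covers
r = max(‖x - y‖, a). -/
theorem renyiDiv_pow_succ_le {E : Type*} [NormedAddCommGroup E] [NormedSpace ℝ E]
    [MeasurableSpace E] {q : ℝ≥0∞} (hq : 1 ≤ q) {P Phat : Kernel E E} [IsMarkovKernel P]
    [IsMarkovKernel Phat] {c c' L a b : ℝ} (hc : 0 ≤ c) (hc' : 0 ≤ c') (hL0 : 0 ≤ L) (hL : L ≤ 1)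
    (ha : 0 ≤ a)
    (regularity : ∀ x y : E, renyiDiv q (P x) (P y) ≤ ((c * ‖x - y‖ ^ 2 : ℝ) : EReal))
    (wasserstein : ∀ x y : E,
      ((wassersteinInf (Phat x) (P y) : ℝ≥0∞) : EReal) ≤ ((L * ‖x - y‖ + a : ℝ) : EReal))
    (crossRegularity : ∀ x y : E,
      renyiDiv q (Phat x) (P y) ≤ ((c' * ‖x - y‖ ^ 2 + b ^ 2 : ℝ) : EReal))
    (n : ℕ) {x y : E} {r : ℝ} (hxy : ‖x - y‖ ≤ r) (hr : n = 0 ∨ a ≤ r) :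
    renyiDiv q ((Phat ^ (n + 1)) x) ((P ^ (n + 1)) y) ≤
      ((geomCouplingBound c c' L a b n r : ℝ) : EReal) := by
  induction n generalizing x y r with
  | zero =>
    simp only [zero_add, pow_one]
    refine (crossRegularity x y).trans (EReal.coe_le_coe_iff.2 ?_)
    simp only [geomCouplingBound, zero_add, Finset.sum_range_one, Finset.sum_range_zero, pow_zero,
      sub_self, mul_zero, add_zero, one_mul, div_one]
    gcongr
  | succ n ih =>
    have har : a ≤ r := hr.resolve_left n.succ_ne_zero
    set u := firstShift L a n r with hu
    have hu0 : 0 ≤ u := firstShift_nonneg hL0 ha ((norm_nonneg _).trans hxy) n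
    have hur : u ≤ r := firstShift_le hL0 hL ha har n
    obtain ⟨z, hzy, hxz⟩ := exists_norm_sub_le_and_norm_sub_le hxy hu0 hur
    set r' := L * (r - u) + a with hr'
    -- The condition a ≤ r is thus needed only at the start: it reproduces itself.
    have har' : a ≤ r' := by
      have : 0 ≤ L * (r - u) := mul_nonneg hL0 (sub_nonneg.2 hur)
      linarith
    rw [geomCouplingBound_succ]
    have hreg : renyiDiv q (P z) (P y) ≤ ((c * u ^ 2 : ℝ) : EReal) :=
      (regularity z y).trans (EReal.coe_le_coe_iff.2 (by gcongr))
    have hW : wassersteinInf (Phat x) (P z) ≤ ENNReal.ofReal r' := by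
      rw [← EReal.coe_ennreal_le_coe_ennreal_iff, EReal.coe_ennreal_ofReal,
        max_eq_left (ha.trans har')]
      exact (wasserstein x z).trans (EReal.coe_le_coe_iff.2 (by rw [hr']; gcongr))
    -- A coupling attaining the infimum in W_∞ is not assumed, so ε of room is left and removed by
    -- continuity of the bound.
    have hstep : ∀ ε : ℝ, 0 < ε → renyiDiv q ((Phat ^ (n + 1 + 1)) x) ((P ^ (n + 1 + 1)) y) ≤
        ((c * u ^ 2 + geomCouplingBound c c' L a b n (r' + ε) : ℝ) : EReal) := fun ε hε => by
      obtain ⟨γ, hγ, hγr⟩ := exists_coupling_of_wassersteinInf_lt (hW.trans_lt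
        ((ENNReal.ofReal_lt_ofReal_iff (by linarith)).2 (lt_add_of_pos_right r' hε)))
      rw [pow_succ Phat, pow_succ P]
      change renyiDiv q (((Phat ^ (n + 1)) ∘ₖ Phat) x) (((P ^ (n + 1)) ∘ₖ P) y) ≤ _
      rw [Kernel.comp_apply, Kernel.comp_apply]
      exact renyiDiv_bind_le hq hγ hreg (hγr.mono fun w hw => ih hw (Or.inr (by linarith)))
    have hlim : Filter.Tendsto
        (fun ε : ℝ => ((c * u ^ 2 + geomCouplingBound c c' L a b n (r' + ε) : ℝ) : EReal))
        (nhdsWithin 0 (Set.Ioi 0))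
        (nhds ((c * u ^ 2 + geomCouplingBound c c' L a b n r' : ℝ) : EReal)) := by
      have hcont : Continuous
          fun ε : ℝ => ((c * u ^ 2 + geomCouplingBound c c' L a b n (r' + ε) : ℝ) : EReal) := by
        have := continuous_geomCouplingBound c c' L a b n
        exact continuous_coe_real_ereal.comp (by fun_prop)
      simpa using (hcont.tendsto 0).mono_left nhdsWithin_le_nhds
    exact ge_of_tendsto hlim (Filter.eventually_of_mem self_mem_nhdsWithin hstep)

theorem nonneg_of_forall_pos_mul_add_nonneg {s t : ℝ} (h : ∀ r : ℝ, 0 < r → 0 ≤ s * r + t) :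
    0 ≤ s := by
  by_contra! hs
  have h1 := h ((|t| + 1) / -s) (div_pos (by positivity) (neg_pos.2 hs))
  have h2 : s * ((|t| + 1) / -s) = -(|t| + 1) := by
    rw [div_neg, mul_neg, mul_div_cancel₀ _ hs.ne]
  have := le_abs_self t
  linarith

theorem theoremA5 (d : ℕ) (hd : 1 ≤ d) (q : ℝ≥0∞) (hq : 1 ≤ q)
    (P Phat : Kernel (EuclideanSpace ℝ (Fin d)) (EuclideanSpace ℝ (Fin d)))
    [IsMarkovKernel P] [IsMarkovKernel Phat]
    (c c' L a b : ℝ)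
    (regularity : ∀ x y : EuclideanSpace ℝ (Fin d),
      renyiDiv q (P x) (P y) ≤ ((c * ‖x - y‖ ^ 2 : ℝ) : EReal))
    (wasserstein : ∀ x y : EuclideanSpace ℝ (Fin d),
      ((wassersteinInf (Phat x) (P y) : ℝ≥0∞) : EReal) ≤ ((L * ‖x - y‖ + a : ℝ) : EReal))
    (crossRegularity : ∀ x y : EuclideanSpace ℝ (Fin d),
      renyiDiv q (Phat x) (P y) ≤ ((c' * ‖x - y‖ ^ 2 + b ^ 2 : ℝ) : EReal))
    (hL : L ≤ 1) (N : ℕ) (hN : 1 ≤ N) (x y : EuclideanSpace ℝ (Fin d)) :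
    ((N = 1 ∨ a ≤ ‖x - y‖) →
      renyiDiv q ((Phat ^ N) x) ((P ^ N) y) ≤
        ((couplingBound c c' L a b N ‖x - y‖ : ℝ) : EReal)) ∧
    renyiDiv q ((Phat ^ N) x) ((P ^ N) y) ≤
      ((couplingBound c c' L a b N (max ‖x - y‖ a) : ℝ) : EReal) := by
  -- Since d ≥ 1, all distances occur; this forces the signs of c, c' and L.
  have hpt : ∀ r : ℝ, 0 < r → ∃ v : EuclideanSpace ℝ (Fin d), ‖v - 0‖ = r := fun r hr =>
    ⟨EuclideanSpace.single ⟨0, hd⟩ r, by simp [abs_of_pos hr]⟩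
  have hW0 : ∀ x y : EuclideanSpace ℝ (Fin d), 0 ≤ L * ‖x - y‖ + a := fun x y => by
    have := (EReal.coe_ennreal_nonneg _).trans (wasserstein x y)
    exact_mod_cast this
  have ha : 0 ≤ a := by simpa using hW0 0 0
  have hL0 : 0 ≤ L := nonneg_of_forall_pos_mul_add_nonneg (t := a) fun r hr => by
    obtain ⟨v, hv⟩ := hpt r hr
    simpa only [hv] using hW0 v 0
  have hc : 0 ≤ c := by
    obtain ⟨v, hv⟩ := hpt 1 one_pos
    have := nonneg_of_renyiDiv_le hq (regularity v 0)
    rwa [hv, one_pow, mul_one] at this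
  have hc' : 0 ≤ c' := nonneg_of_forall_pos_mul_add_nonneg (t := b ^ 2) fun r hr => by
    obtain ⟨v, hv⟩ := hpt (√r) (Real.sqrt_pos.2 hr)
    have := nonneg_of_renyiDiv_le hq (crossRegularity v 0)
    rwa [hv, Real.sq_sqrt hr.le] at this
  obtain ⟨n, rfl⟩ := Nat.exists_eq_add_of_le' hN
  simp only [couplingBound_eq_geomCouplingBound _ _ _ _ _ hL0]
  exact ⟨fun h => renyiDiv_pow_succ_le hq hc hc' hL0 hL ha regularity wasserstein crossRegularity n
      le_rfl (h.imp_left fun h => by omega),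
    renyiDiv_pow_succ_le hq hc hc' hL0 hL ha regularity wasserstein crossRegularity n
      (le_max_left _ _) (Or.inr (le_max_right _ _))⟩
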